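/- Let $\ell_\infty$ be the Banach space of bounded real sequences $x=(x_k)_{k\in\omega}$ with the supremum norm. A function $f:\ell_\infty\to[0,1]$ is strongly separately continuous if for all $x^0\in\ell_\infty$, all $k$ and all $\varepsilon>0$ there is $\delta>0$ such that $|f(x)-f(x')|<\varepsilon$ whenever $\|x-x^0\|_\infty<\delta$ and $x'$ is obtained from $x$ by replacing its $k$-th term by $x^0_k$. A set $A\subseteq\ell_\infty$ is $\mathcal S$-open if for every $a\in A$ it contains all sequences that differ from $a$ in at most one term. The functions of Baire class $0$ are the continuous functions $\ell_\infty\to[0,1]$; those of Baire class $\alpha>0$ are the pointwise limits of sequences of functions of Baire classes $<\alpha$. The sets of additive class $0$ are the open sets, those of additive class $\alpha>0$ are the countable unions of sets of multiplicative classes $<\alpha$, and a set is of multiplicative class $\alpha$ if its complement is of additive class $\alpha$. For an ordinal $\alpha$ put $\alpha^\bullet=\alpha$ if $\alpha$ is finite and $\alpha^\bullet=\alpha+1$ if $\alpha$ is infinite. Theorem. For every countable ordinal $\alpha\in[0,\omega_1)$ there exists a strongly separately continuous function $f:\ell_\infty\to[0,1]$ that belongs to the Baire class $(\alpha+1)^\bullet$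 and does not belong to the Baire class $\alpha$. Moreover, $f$ can be taken to be the indicator function of an $\mathcal S$-open set $A\subseteq\ell_\infty$ that is of additive class $\alpha^\bullet$ and not of multiplicative class $\alpha^\bullet$. -/

import Mathlib

open scoped Topology Ordinal

/-- The Banach space of bounded real sequences with the supremum norm. -/
abbrev EllInfty : Type := lp (fun _ : ℕ => ℝ) ⊤

theorem memℓp_infty_update (x : EllInfty) (k : ℕ) (t : ℝ) :
    Memℓp (Function.update (x : ℕ → ℝ) k t) ⊤ := by
  obtain ⟨C, hC⟩ := memℓp_infty_iff.1 (lp.memℓp x)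
  refine memℓp_infty_iff.2 ⟨max C ‖t‖, ?_⟩
  rintro _ ⟨i, rfl⟩
  by_cases h : i = k
  · subst h
    simp
  · simpa [Function.update_of_ne h] using Or.inl (hC ⟨i, rfl⟩)

/-- The bounded sequence obtained from `x` by replacing its `k`-th term by `t`. -/
def EllInfty.update (x : EllInfty) (k : ℕ) (t : ℝ) : EllInfty :=
  ⟨Function.update (x : ℕ → ℝ) k t, memℓp_infty_update x k t⟩

/-- Strong separate continuity at the point `x₀` with respect to the `k`-th variable. -/
def SSCAtVar {Y : Type*} [MetricSpace Y] (f : EllInfty → Y) (x₀ : EllInfty) (k : ℕ) : Prop :=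
  ∀ ε > 0, ∃ δ > 0, ∀ x ∈ Metric.ball x₀ δ, dist (f x) (f (x.update k (x₀ k))) < ε

/-- Strong separate continuity: at every point, with respect to every variable. -/
def StronglySeparatelyContinuous {Y : Type*} [MetricSpace Y] (f : EllInfty → Y) : Prop :=
  ∀ (x₀ : EllInfty) (k : ℕ), SSCAtVar f x₀ k

/-- A set of bounded sequences is `𝒮`-open if with each point `a` it contains all sequences that
differ from `a` in at most one term (such a sequence is automatically bounded). -/
def IsSOpen (A : Set EllInfty) : Prop :=
  ∀ a ∈ A, ∀ x : EllInfty, {k : ℕ | x k ≠ a k}.encard ≤ 1 → x ∈ A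

/-- `IsBaireClass α f`: the function `f` belongs to the `α`-th Baire class. Class `0` consists of
the continuous functions, class `α > 0` of the pointwise limits of sequences of functions from
classes of index less than `α`. -/
inductive IsBaireClass {X Y : Type*} [TopologicalSpace X] [TopologicalSpace Y] :
    Ordinal.{0} → (X → Y) → Prop
  | continuous {f : X → Y} (hf : Continuous f) : IsBaireClass 0 f
  | limit {α : Ordinal.{0}} {f : X → Y} (β : ℕ → Ordinal.{0}) (g : ℕ → X → Y)
      (hβ : ∀ n, β n < α) (hg : ∀ n, IsBaireClass (β n) (g n))
      (hf : ∀ x, Filter.Tendsto (fun n => g n x) Filter.atTop (𝓝 (f x))) : IsBaireClass α f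

/-- `IsAdditiveClass α A`: the set `A` is of additive Borel class `α`. Additive class `0` consists
of the open sets, additive class `α > 0` of the countable unions of sets of multiplicative classes
of index less than `α`; a set is of multiplicative class `β` if its complement is of additive
class `β`. -/
inductive IsAdditiveClass {X : Type*} [TopologicalSpace X] : Ordinal.{0} → Set X → Prop
  | isOpen {A : Set X} (hA : IsOpen A) : IsAdditiveClass 0 A
  | iUnion {α : Ordinal.{0}} (β : ℕ → Ordinal.{0}) (A : ℕ → Set X)
      (hβ : ∀ n, β n < α) (hA : ∀ n, IsAdditiveClass (β n) (A n)ᶜ) :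
      IsAdditiveClass α (⋃ n, A n)

/-- Multiplicative Borel class `α`; for `α = 0` these are the closed sets. -/
def IsMultiplicativeClass {X : Type*} [TopologicalSpace X] (α : Ordinal.{0}) (A : Set X) : Prop :=
  IsAdditiveClass α Aᶜ

/-- The ordinal `α^•`: equal to `α` if `α` is finite and to `α + 1` if `α` is infinite. -/
noncomputable def bullet (α : Ordinal.{0}) : Ordinal.{0} :=
  if α < ω then α else α + 1

/-! The map limsup on `EllInfty` is continuous, ignores changes in finitely many terms, and has the
constant sequences as a continuous section. Let `A` be its preimage of a set `B ⊆ ℝ` of additive but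
not multiplicative class `bullet α`. Continuity puts `A` in the additive class, the section keeps it
out of the multiplicative one, and invariance makes `A` `𝒮`-open and its indicator strongly
separately continuous. The set `B` comes from diagonalizing a universal set on the Cantor space,
embedded in `ℝ`. Lebesgue–Hausdorff arguments turn the Borel class of `A` into Baire bounds for the
indicator. -/

open Filter Set

/-! ### Additive classes and universal sets -/

section AdditiveClass

variable {X Y : Type*} [TopologicalSpace X] [TopologicalSpace Y]

theorem isAdditiveClass_zero_iff {A : Set X} : IsAdditiveClass 0 A ↔ IsOpen A := by
  refine ⟨fun h => ?_, .isOpen⟩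
  cases h with
  | isOpen hA => exact hA
  | iUnion β A hβ _ => exact absurd (hβ 0) not_lt_zero

theorem isAdditiveClass_iff_of_pos {α : Ordinal.{0}} (hα : 0 < α) {A : Set X} :
    IsAdditiveClass α A ↔ ∃ (β : ℕ → Ordinal.{0}) (B : ℕ → Set X), (∀ n, β n < α) ∧
      (∀ n, IsAdditiveClass (β n) (B n)ᶜ) ∧ A = ⋃ n, B n := by
  refine ⟨fun h => ?_, ?_⟩
  · cases h with
    | isOpen hA => exact absurd hα (lt_irrefl _)
    | iUnion β B hβ hB => exact ⟨β, B, hβ, hB, rfl⟩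
  · rintro ⟨β, B, hβ, hB, rfl⟩
    exact .iUnion β B hβ hB

theorem IsAdditiveClass.preimage {α : Ordinal.{0}} {A : Set Y} (hA : IsAdditiveClass α A)
    {f : X → Y} (hf : Continuous f) : IsAdditiveClass α (f ⁻¹' A) := by
  induction hA with
  | isOpen hA => exact .isOpen (hA.preimage hf)
  | iUnion β A hβ _ ih =>
    rw [preimage_iUnion]
    exact .iUnion β _ hβ ih

/-- Sets of additive class `α` extend along inducing maps. -/
theorem IsAdditiveClass.exists_preimage_eq {α : Ordinal.{0}} {A : Set X}
    (hA : IsAdditiveClass α A) {f : X → Y} (hf : Topology.IsInducing f) :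
    ∃ B : Set Y, IsAdditiveClass α B ∧ f ⁻¹' B = A := by
  induction hA with
  | isOpen hA =>
    obtain ⟨B, hB, rfl⟩ := hf.isOpen_iff.1 hA
    exact ⟨B, .isOpen hB, rfl⟩
  | iUnion β A hβ _ ih =>
    choose B hB hBA using ih
    refine ⟨⋃ n, (B n)ᶜ, .iUnion β _ hβ fun n => by simpa using hB n, ?_⟩
    simp only [preimage_iUnion, preimage_compl, hBA, compl_compl]

theorem isAdditiveClass_univ (α : Ordinal.{0}) : IsAdditiveClass α (univ : Set X) := by
  rcases eq_or_ne α 0 with rfl | hα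
  · exact .isOpen isOpen_univ
  · exact (isAdditiveClass_iff_of_pos (pos_iff_ne_zero.2 hα)).2
      ⟨fun _ => 0, fun _ => univ, fun _ => pos_iff_ne_zero.2 hα,
        fun _ => .isOpen (by simp), (iUnion_const _).symm⟩

theorem IsAdditiveClass.compl_of_lt {α β : Ordinal.{0}} {A : Set X} (hA : IsAdditiveClass α A)
    (h : α < β) : IsAdditiveClass β Aᶜ :=
  (isAdditiveClass_iff_of_pos (pos_of_gt h)).2
    ⟨fun _ => α, fun _ => Aᶜ, fun _ => h, fun _ => by simpa using hA, (iUnion_const _).symm⟩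

theorem IsAdditiveClass.iUnion_nat {α : Ordinal.{0}} {A : ℕ → Set X}
    (hA : ∀ n, IsAdditiveClass α (A n)) : IsAdditiveClass α (⋃ n, A n) := by
  rcases eq_or_ne α 0 with rfl | hα
  · exact .isOpen (isOpen_iUnion fun n => isAdditiveClass_zero_iff.1 (hA n))
  · have hpos := pos_iff_ne_zero.2 hα
    choose β B hβ hB hAB using fun n => (isAdditiveClass_iff_of_pos hpos).1 (hA n)
    refine (isAdditiveClass_iff_of_pos hpos).2 ⟨fun n => β n.unpair.1 n.unpair.2,
      fun n => B n.unpair.1 n.unpair.2, fun n => hβ _ _, fun n => hB _ _, ?_⟩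
    rw [iUnion_unpair]
    exact iUnion_congr hAB

/-- For every countable ordinal there is a set universal for the given additive class,
parametrized by the Cantor space. -/
theorem exists_universal_isAdditiveClass [SecondCountableTopology X] (α : Ordinal.{0})
    (hα : α < ω₁) : ∃ U : Set ((ℕ → Bool) × X), IsAdditiveClass α U ∧
      ∀ A : Set X, IsAdditiveClass α A → ∃ y, A = {x | (y, x) ∈ U} := by
  induction α using WellFoundedLT.induction with
  | ind α ih =>
  rcases eq_or_ne α 0 with rfl | hα0
  · obtain ⟨b, hbc, -, hb⟩ := TopologicalSpace.exists_countable_basis X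
    rcases b.eq_empty_or_nonempty with rfl | hne
    · refine ⟨∅, .isOpen isOpen_empty, fun A hA => ⟨fun _ => false, ?_⟩⟩
      obtain ⟨S, hS, rfl⟩ := hb.open_eq_sUnion (isAdditiveClass_zero_iff.1 hA)
      simp [subset_empty_iff.1 hS]
    · obtain ⟨V, rfl⟩ := hbc.exists_eq_range hne
      -- The code `y` selects which basic open sets enter the union.
      refine ⟨⋃ n, {y : ℕ → Bool | y n = true} ×ˢ V n, .isOpen (isOpen_iUnion fun n => ?_),
        fun A hA => ?_⟩
      · have hn : Continuous fun y : ℕ → Bool => y n := continuous_apply n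
        exact ((isOpen_discrete {true}).preimage hn).prod (hb.isOpen ⟨n, rfl⟩)
      · classical
        refine ⟨fun n => decide (V n ⊆ A), ?_⟩
        ext x
        simp only [mem_ofPred_eq, mem_iUnion, mem_prod, decide_eq_true_eq]
        refine ⟨fun hx => ?_, fun ⟨n, hn, hx⟩ => hn hx⟩
        obtain ⟨_, ⟨n, rfl⟩, hxn, hn⟩ :=
          hb.exists_subset_of_mem_open hx (isAdditiveClass_zero_iff.1 hA)
        exact ⟨n, hn, hxn⟩
  · have hpos := pos_iff_ne_zero.2 hα0
    have hcount : (Iio α).Countable := by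
      rw [← Cardinal.le_aleph0_iff_set_countable, Cardinal.mk_Iio_ordinal, Cardinal.lift_le_aleph0,
        ← Order.lt_succ_iff, Cardinal.succ_aleph0]
      rwa [← Cardinal.lt_ord, Cardinal.ord_aleph]
    obtain ⟨b, hb⟩ := hcount.exists_eq_range ⟨0, hpos⟩
    have hbα : ∀ m, b m < α := fun m => hb.symm.subset ⟨m, rfl⟩
    choose U hU hUuniv using fun m => ih (b m) (hbα m) ((hbα m).trans hα)
    -- `row n` reads off the `n`-th of the countably many codes packed into one.
    let row (n : ℕ) (p : (ℕ → Bool) × X) : (ℕ → Bool) × X := (fun j => p.1 (Nat.pair n j), p.2)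
    have hrow (n : ℕ) : Continuous (row n) := by fun_prop
    refine ⟨⋃ n, (row n ⁻¹' U n.unpair.1)ᶜ, .iUnion (fun n => b n.unpair.1) _ (fun n => hbα _)
      fun n => ?_, fun A hA => ?_⟩
    · rw [compl_compl]
      exact (hU _).preimage (hrow n)
    · obtain ⟨β, B, hβ, hB, rfl⟩ := (isAdditiveClass_iff_of_pos hpos).1 hA
      have hm (n : ℕ) : ∃ m, b m = β n := by
        have : β n ∈ range b := hb ▸ hβ n
        exact this
      choose m hm using hm
      -- The class of slot `n = ⟨i, j⟩` is fixed in advance as `b i`. The set `B j` goes into slot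
      -- `⟨m j, j⟩`, whose class fits it; every other slot is coded to be empty.
      have key (n : ℕ) : ∃ y : ℕ → Bool, {x | (y, x) ∉ U n.unpair.1} =
          if m n.unpair.2 = n.unpair.1 then B n.unpair.2 else ∅ := by
        split_ifs with h
        · obtain ⟨y, hy⟩ := hUuniv n.unpair.1 (B n.unpair.2)ᶜ (by
            rw [← h, hm]
            exact hB _)
          exact ⟨y, by rw [← compl_compl (B n.unpair.2), hy]; rfl⟩
        · obtain ⟨y, hy⟩ := hUuniv n.unpair.1 univ (isAdditiveClass_univ _)
          exact ⟨y, by rw [← compl_univ, hy]; rfl⟩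
      choose y hy using key
      refine ⟨fun k => y k.unpair.1 k.unpair.2, ?_⟩
      have hmem (n : ℕ) (x : X) : (fun k : ℕ => y k.unpair.1 k.unpair.2, x) ∈
          (row n ⁻¹' U n.unpair.1)ᶜ ↔
            x ∈ if m n.unpair.2 = n.unpair.1 then B n.unpair.2 else (∅ : Set X) := by
        rw [← hy]
        simp [row]
      ext x
      simp only [mem_ofPred_eq, mem_iUnion, hmem]
      constructor
      · rintro ⟨n, hn⟩
        exact ⟨Nat.pair (m n) n, by simpa using hn⟩
      · rintro ⟨n, hn⟩
        split_ifs at hn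
        · exact ⟨_, hn⟩
        · exact absurd hn (notMem_empty x)

/-- The additive classes of the real line are not closed under complements. -/
theorem exists_isAdditiveClass_not_isMultiplicativeClass_real (α : Ordinal.{0}) (hα : α < ω₁) :
    ∃ B : Set ℝ, IsAdditiveClass α B ∧ ¬ IsMultiplicativeClass α B := by
  obtain ⟨U, hU, hUuniv⟩ := exists_universal_isAdditiveClass (X := ℕ → Bool) α hα
  obtain ⟨e, -, he, hinj⟩ :=
    (PerfectSpace.univ_perfect (α := ℝ)).exists_nat_bool_injection univ_nonempty
  have hdiag : Continuous fun y : ℕ → Bool => (y, y) := by fun_prop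
  obtain ⟨B, hB, hBU⟩ := (hU.preimage hdiag).exists_preimage_eq (he.isClosedEmbedding hinj).isInducing
  refine ⟨B, hB, fun hB' => ?_⟩
  -- `y` codes the complement of the diagonal set, so it refutes itself.
  obtain ⟨y, hy⟩ := hUuniv _ (IsAdditiveClass.preimage hB' he)
  rw [preimage_compl, hBU] at hy
  have : (y, y) ∉ U ↔ (y, y) ∈ U := Set.ext_iff.1 hy y
  exact iff_not_self this.symm

end AdditiveClass

/-! ### Inclusions between additive classes -/

section MonotoneAdditiveClass

variable {X : Type*} [PseudoEMetricSpace X]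

/-- The metric matters only at class `0`: open sets are countable unions of closed ones. -/
theorem IsAdditiveClass.mono {α β : Ordinal.{0}} {A : Set X} (hA : IsAdditiveClass α A)
    (h : α ≤ β) : IsAdditiveClass β A := by
  rcases h.eq_or_lt with rfl | h
  · exact hA
  rcases eq_or_ne α 0 with rfl | hα
  · obtain ⟨F, hF, -, hFA, -⟩ := (isAdditiveClass_zero_iff.1 hA).exists_iUnion_isClosed
    exact (isAdditiveClass_iff_of_pos h).2
      ⟨fun _ => 0, F, fun _ => h, fun n => .isOpen (hF n).isOpen_compl, hFA.symm⟩
  · obtain ⟨γ, B, hγ, hB, rfl⟩ := (isAdditiveClass_iff_of_pos (pos_iff_ne_zero.2 hα)).1 hA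
    exact .iUnion γ B (fun n => (hγ n).trans h) hB

end MonotoneAdditiveClass

/-! ### Baire classes -/

section BaireClass

variable {X Y Z : Type*} [TopologicalSpace X] [TopologicalSpace Y] [TopologicalSpace Z]

theorem IsBaireClass.mono {α β : Ordinal.{0}} {f : X → Y} (hf : IsBaireClass α f) (h : α ≤ β) :
    IsBaireClass β f := by
  rcases h.eq_or_lt with rfl | h
  · exact hf
  · exact .limit (fun _ => α) (fun _ => f) (fun _ => h) (fun _ => hf) fun _ => tendsto_const_nhds

theorem isBaireClass_zero_iff {f : X → Y} : IsBaireClass 0 f ↔ Continuous f := by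
  refine ⟨fun h => ?_, .continuous⟩
  cases h with
  | continuous hf => exact hf
  | limit β g hβ _ _ => exact absurd (hβ 0) not_lt_zero

theorem IsBaireClass.exists_seq {α : Ordinal.{0}} (hα : 0 < α) {f : X → Y}
    (hf : IsBaireClass α f) : ∃ (β : ℕ → Ordinal.{0}) (g : ℕ → X → Y), (∀ n, β n < α) ∧
      (∀ n, IsBaireClass (β n) (g n)) ∧ ∀ x, Tendsto (fun n => g n x) atTop (𝓝 (f x)) := by
  cases hf with
  | continuous hf => exact absurd hα (lt_irrefl _)
  | limit β g hβ hg hf => exact ⟨β, g, hβ, hg, hf⟩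

theorem IsBaireClass.comp₂ {α : Ordinal.{0}} {f g : X → Y} (hf : IsBaireClass α f)
    (hg : IsBaireClass α g) {h : Y × Y → Z} (hh : Continuous h) :
    IsBaireClass α fun x => h (f x, g x) := by
  induction α using WellFoundedLT.induction generalizing f g with
  | ind α ih =>
  rcases eq_or_ne α 0 with rfl | hα
  · rw [isBaireClass_zero_iff] at *
    exact hh.comp (hf.prodMk hg)
  · obtain ⟨β, F, hβ, hF, hFf⟩ := hf.exists_seq (pos_iff_ne_zero.2 hα)
    obtain ⟨γ, G, hγ, hG, hGg⟩ := hg.exists_seq (pos_iff_ne_zero.2 hα)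
    exact .limit (fun n => max (β n) (γ n)) (fun n x => h (F n x, G n x))
      (fun n => max_lt (hβ n) (hγ n))
      (fun n => ih _ (max_lt (hβ n) (hγ n)) ((hF n).mono (le_max_left _ _))
        ((hG n).mono (le_max_right _ _)))
      fun x => (hh.tendsto _).comp ((hFf x).prodMk_nhds (hGg x))

end BaireClass

/-! ### Indicators of sets of additive class -/

section Indicator

open Classical in
/-- The indicator function of a set, with values in the unit interval. -/
noncomputable def unitIndicator {X : Type*} (A : Set X) (x : X) : Set.Icc (0 : ℝ) 1 :=
  if x ∈ A then 1 else 0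

variable {X : Type*}

theorem unitIndicator_of_mem {A : Set X} {x : X} (h : x ∈ A) : unitIndicator A x = 1 := if_pos h

theorem unitIndicator_of_notMem {A : Set X} {x : X} (h : x ∉ A) : unitIndicator A x = 0 :=
  if_neg h

theorem symm_unitIndicator_compl (A : Set X) (x : X) :
    unitInterval.symm (unitIndicator Aᶜ x) = unitIndicator A x := by
  by_cases h : x ∈ A <;> simp [unitIndicator, h]

theorem unitIndicator_union (A B : Set X) (x : X) :
    unitIndicator (A ∪ B) x = max (unitIndicator A x) (unitIndicator B x) := by
  by_cases hA : x ∈ A <;> by_cases hB : x ∈ B <;> simp [unitIndicator, hA, hB]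

/-- Truncate `n` times the distance to the complement; `univ` is separate because `infDist` to `∅`
is `0`. -/
theorem isBaireClass_one_unitIndicator_of_isOpen [PseudoMetricSpace X] {A : Set X}
    (hA : IsOpen A) : IsBaireClass 1 (unitIndicator A) := by
  rcases eq_or_ne A univ with rfl | hne
  · refine (IsBaireClass.continuous ?_).mono zero_le_one
    have : unitIndicator (univ : Set X) = fun _ => 1 :=
      funext fun x => unitIndicator_of_mem (mem_univ x)
    rw [this]
    exact continuous_const
  · have hne' : Aᶜ.Nonempty := nonempty_compl.2 hne
    refine .limit (fun _ => 0)
      (fun n x => projIcc (0 : ℝ) 1 zero_le_one (n * Metric.infDist x Aᶜ)) (fun _ => zero_lt_one)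
      (fun n => .continuous (continuous_projIcc.comp
        (continuous_const.mul (Metric.continuous_infDist_pt _)))) fun x => ?_
    by_cases hx : x ∈ A
    · have hpos : 0 < Metric.infDist x Aᶜ :=
        (hA.isClosed_compl.notMem_iff_infDist_pos hne').1 (by simpa using hx)
      have htop : Tendsto (fun n : ℕ => (n : ℝ) * Metric.infDist x Aᶜ) atTop atTop :=
        tendsto_natCast_atTop_atTop.atTop_mul_const hpos
      rw [unitIndicator_of_mem hx]
      refine tendsto_const_nhds.congr' ?_
      filter_upwards [htop.eventually_ge_atTop 1] with n hn
      exact (projIcc_of_right_le _ hn).symm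
    · rw [unitIndicator_of_notMem hx]
      simp only [Metric.infDist_zero_of_mem (s := Aᶜ) hx, mul_zero]
      exact tendsto_const_nhds.congr fun _ => (projIcc_left _).symm

/-- The indicators of the finite partial unions are eventually constant at each point. -/
theorem IsAdditiveClass.isBaireClass_unitIndicator [PseudoMetricSpace X] {α : Ordinal.{0}}
    {A : Set X} (hA : IsAdditiveClass α A) : IsBaireClass (α + 1) (unitIndicator A) := by
  induction hA with
  | isOpen hA => simpa using isBaireClass_one_unitIndicator_of_isOpen hA
  | @iUnion α β A hβ _ ih =>
    have hA (n : ℕ) : IsBaireClass α (unitIndicator (A n)) := by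
      have h := ((ih n).comp₂ (ih n) (unitInterval.continuous_symm.comp continuous_fst)).mono
        (Order.add_one_le_of_lt (hβ n))
      simpa only [Function.comp_apply, symm_unitIndicator_compl] using h
    have hS (n : ℕ) : IsBaireClass α (unitIndicator (accumulate A n)) := by
      induction n with
      | zero => simpa [accumulate_zero_nat] using hA 0
      | succ n ihn =>
        have h := ihn.comp₂ (hA (n + 1)) (continuous_fst.max continuous_snd)
        simpa only [accumulate_succ, ← unitIndicator_union] using h
    refine .limit (fun _ => α) (fun n => unitIndicator (accumulate A n))
      (fun _ => Order.lt_add_one_iff.2 le_rfl) hS fun x => tendsto_const_nhds.congr' ?_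
    by_cases hx : x ∈ ⋃ n, A n
    · obtain ⟨k, hk⟩ := mem_iUnion.1 hx
      filter_upwards [eventually_ge_atTop k] with n hn
      rw [unitIndicator_of_mem hx, unitIndicator_of_mem (mem_accumulate.2 ⟨k, hn, hk⟩)]
    · refine Eventually.of_forall fun n => ?_
      beta_reduce
      rw [unitIndicator_of_notMem hx, unitIndicator_of_notMem fun h =>
        hx (accumulate_subset_iUnion n h)]

end Indicator

/-! ### The shift `bullet` and the Lebesgue–Hausdorff theorem -/

theorem bullet_lt_omega_one {α : Ordinal.{0}} (hα : α < ω₁) : bullet α < ω₁ := by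
  unfold bullet
  split_ifs
  · exact hα
  · exact (Cardinal.isSuccLimit_omega 1).add_one_lt hα

theorem bullet_add_one_le (α : Ordinal.{0}) : bullet α + 1 ≤ bullet (α + 1) := by
  unfold bullet
  by_cases h : α < ω
  · have h' : α + 1 < ω := Ordinal.isSuccLimit_omega0.add_one_lt h
    simp [h, h']
  · have h' : ¬ α + 1 < ω := fun h' => h ((Order.lt_add_one_iff.2 le_rfl).trans h')
    simp [h, h']

/-- Provides one class holding countably many preimages at once. At a limit `α` no bound below `α`
need exist, hence the extra `1` in `bullet`. -/
theorem exists_lt_bullet_forall_bullet_le {α : Ordinal.{0}} (hα : 0 < α) :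
    ∃ δ < bullet α, ∀ β < α, bullet β ≤ δ := by
  by_cases h : α < ω
  · obtain ⟨n, rfl⟩ := Ordinal.lt_omega0.1 h
    obtain ⟨m, rfl⟩ : ∃ m, n = m + 1 := Nat.exists_eq_succ_of_ne_zero (by
      rintro rfl
      simp at hα)
    refine ⟨m, ?_, fun β hβ => ?_⟩
    · rw [bullet, if_pos h]
      exact_mod_cast Nat.lt_succ_self m
    · rw [bullet, if_pos (hβ.trans h)]
      rw [Nat.cast_succ] at hβ
      exact Order.lt_add_one_iff.1 hβ
  · refine ⟨α, ?_, fun β hβ => ?_⟩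
    · rw [bullet, if_neg h]
      exact Order.lt_add_one_iff.2 le_rfl
    · unfold bullet
      split_ifs
      · exact hβ.le
      · exact Order.add_one_le_of_lt hβ

/-- The Lebesgue–Hausdorff theorem, easy direction. -/
theorem IsBaireClass.isAdditiveClass_preimage {X Y : Type*} [PseudoEMetricSpace X]
    [PseudoEMetricSpace Y] {α : Ordinal.{0}} {f : X → Y} (hf : IsBaireClass α f) {W : Set Y}
    (hW : IsOpen W) : IsAdditiveClass (bullet α) (f ⁻¹' W) := by
  induction hf generalizing W with
  | continuous hf => exact (IsAdditiveClass.isOpen (hW.preimage hf)).mono zero_le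
  | @limit α f β g hβ _ hf ih =>
    obtain ⟨δ, hδ, hβδ⟩ := exists_lt_bullet_forall_bullet_le (pos_of_gt (hβ 0))
    -- Closed sets exhausting `W`; `infEDist` to `∅` is `⊤`, so `W = univ` needs no separate case.
    let F (k : ℕ) : Set Y := {y | ((k : ENNReal) + 1)⁻¹ ≤ Metric.infEDist y Wᶜ}
    have hF (k : ℕ) : IsClosed (F k) :=
      isClosed_le continuous_const Metric.continuous_infEDist
    -- `f x ∈ W` iff for some `k` the values `g n x` eventually stay in `F k`; closedness gives the
    -- converse.
    have hWF : f ⁻¹' W = ⋃ k, ⋃ N, (⋃ n, g (N + n) ⁻¹' (F k)ᶜ)ᶜ := by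
      ext x
      simp only [mem_preimage, mem_iUnion, mem_compl_iff, not_exists, not_not]
      constructor
      · intro hx
        have hpos : 0 < Metric.infEDist (f x) Wᶜ := by
          rw [pos_iff_ne_zero, Ne, ← Metric.mem_iff_infEDist_zero_of_closed hW.isClosed_compl]
          simpa using hx
        obtain ⟨k, hk⟩ := ENNReal.exists_inv_nat_lt hpos.ne'
        have hk' : ((k : ENNReal) + 1)⁻¹ < Metric.infEDist (f x) Wᶜ :=
          (ENNReal.inv_le_inv.2 le_self_add).trans_lt hk
        have hlim := (Metric.continuous_infEDist (s := Wᶜ)).tendsto (f x) |>.comp (hf x)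
        obtain ⟨N, hN⟩ := eventually_atTop.1 (hlim.eventually (lt_mem_nhds hk'))
        exact ⟨k, N, fun n => (hN (N + n) (Nat.le_add_right _ _)).le⟩
      · rintro ⟨k, N, h⟩
        have hmem : f x ∈ F k := (hF k).mem_of_tendsto (hf x) <| by
          filter_upwards [eventually_ge_atTop N] with n hn
          obtain ⟨j, rfl⟩ := Nat.exists_eq_add_of_le hn
          exact h j
        by_contra hx
        have h0 : Metric.infEDist (f x) Wᶜ = 0 := Metric.infEDist_zero_of_mem hx
        have hle : ((k : ENNReal) + 1)⁻¹ ≤ 0 := h0 ▸ hmem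
        simp [ENNReal.inv_eq_zero] at hle
    rw [hWF]
    refine IsAdditiveClass.iUnion_nat fun k => IsAdditiveClass.iUnion_nat fun N => ?_
    exact (IsAdditiveClass.iUnion_nat fun n =>
      (ih _ (hF k).isOpen_compl).mono (hβδ _ (hβ _))).compl_of_lt hδ

/-! ### The upper limit as a continuous tail-invariant map -/

section Limsup

theorem EllInfty.isBoundedUnder_le (x : EllInfty) :
    IsBoundedUnder (· ≤ ·) atTop (x : ℕ → ℝ) :=
  isBoundedUnder_of ⟨‖x‖, fun n => (le_abs_self _).trans
    (lp.norm_apply_le_norm ENNReal.top_ne_zero x n)⟩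

theorem EllInfty.isCoboundedUnder_le (x : EllInfty) :
    IsCoboundedUnder (· ≤ ·) atTop (x : ℕ → ℝ) := by
  have : IsBoundedUnder (· ≥ ·) atTop (x : ℕ → ℝ) :=
    isBoundedUnder_of ⟨-‖x‖, fun n => (abs_le.1
      (lp.norm_apply_le_norm ENNReal.top_ne_zero x n)).1⟩
  exact this.isCoboundedUnder_le

theorem EllInfty.limsup_le_limsup_add_dist (x y : EllInfty) :
    limsup (x : ℕ → ℝ) atTop ≤ limsup (y : ℕ → ℝ) atTop + dist x y := by
  rw [← limsup_add_const atTop (y : ℕ → ℝ) (dist x y) y.isBoundedUnder_le y.isCoboundedUnder_le]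
  refine limsup_le_limsup (Eventually.of_forall fun n => ?_) x.isCoboundedUnder_le ?_
  · have h : |x n - y n| ≤ ‖x - y‖ := lp.norm_apply_le_norm ENNReal.top_ne_zero (x - y) n
    rw [dist_eq_norm]
    linarith [le_abs_self (x n - y n)]
  · exact isBoundedUnder_of ⟨‖y‖ + dist x y, fun n => add_le_add_left ((le_abs_self _).trans
      (lp.norm_apply_le_norm ENNReal.top_ne_zero y n)) _⟩

theorem EllInfty.continuous_limsup :
    Continuous fun x : EllInfty => limsup (x : ℕ → ℝ) atTop :=
  (LipschitzWith.of_le_add EllInfty.limsup_le_limsup_add_dist).continuous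

/-- The constant sequence with the given value. -/
def EllInfty.const (t : ℝ) : EllInfty :=
  ⟨fun _ => t, memℓp_infty_iff.2 ⟨‖t‖, by rintro _ ⟨_, rfl⟩; exact le_rfl⟩⟩

theorem EllInfty.continuous_const : Continuous EllInfty.const := by
  refine (LipschitzWith.of_dist_le_mul (K := 1) fun s t => ?_).continuous
  rw [NNReal.coe_one, one_mul, dist_eq_norm]
  exact lp.norm_le_of_forall_le dist_nonneg fun n => (Real.dist_eq s t).ge

theorem EllInfty.limsup_const (t : ℝ) :
    limsup (EllInfty.const t : ℕ → ℝ) atTop = t :=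
  Filter.limsup_const t

theorem EllInfty.limsup_eq_of_encard_le_one {x a : EllInfty}
    (h : {k : ℕ | x k ≠ a k}.encard ≤ 1) :
    limsup (x : ℕ → ℝ) atTop = limsup (a : ℕ → ℝ) atTop := by
  refine limsup_congr ?_
  rw [← Nat.cofinite_eq_atTop]
  exact (finite_of_encard_le_coe (k := 1) h :)

theorem EllInfty.limsup_update (x : EllInfty) (k : ℕ) (t : ℝ) :
    limsup (x.update k t : ℕ → ℝ) atTop = limsup (x : ℕ → ℝ) atTop := by
  refine limsup_congr ?_
  filter_upwards [eventually_gt_atTop k] with n hn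
  exact Function.update_of_ne hn.ne' _ _

end Limsup

/-! ### The main theorem -/

theorem theorem1 (α : Ordinal.{0}) (hα : α < ω₁) :
    ∃ f : EllInfty → Set.Icc (0 : ℝ) 1,
      StronglySeparatelyContinuous f ∧
      IsBaireClass (bullet (α + 1)) f ∧
      ¬ IsBaireClass α f ∧
      ∃ A : Set EllInfty,
        IsSOpen A ∧
        IsAdditiveClass (bullet α) A ∧
        ¬ IsMultiplicativeClass (bullet α) A ∧
        ∀ x : EllInfty, ((f x : Set.Icc (0 : ℝ) 1) : ℝ) = A.indicator (fun _ => (1 : ℝ)) x := by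
  obtain ⟨B, hB, hB'⟩ :=
    exists_isAdditiveClass_not_isMultiplicativeClass_real _ (bullet_lt_omega_one hα)
  let A : Set EllInfty := (fun x : EllInfty => limsup (x : ℕ → ℝ) atTop) ⁻¹' B
  have hA : IsAdditiveClass (bullet α) A := hB.preimage EllInfty.continuous_limsup
  have hA' : ¬ IsMultiplicativeClass (bullet α) A := fun h => hB' <| by
    have h' := IsAdditiveClass.preimage h EllInfty.continuous_const
    have hAB : EllInfty.const ⁻¹' Aᶜ = Bᶜ := by
      ext t
      simp only [A, mem_preimage, mem_compl_iff, EllInfty.limsup_const]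
    rwa [hAB] at h'
  -- Any `δ` works: changing one term does not change the indicator.
  refine ⟨unitIndicator A, fun x₀ k ε hε => ⟨1, one_pos, fun x _ => ?_⟩,
    hA.isBaireClass_unitIndicator.mono (bullet_add_one_le α), fun hf => hA' ?_, A,
    fun a ha x hx => ?_, hA, hA', fun x => ?_⟩
  · have : unitIndicator A (x.update k (x₀ k)) = unitIndicator A x := by
      have hmem : x.update k (x₀ k) ∈ A ↔ x ∈ A := by
        simp only [A, mem_preimage, EllInfty.limsup_update]
      by_cases h : x ∈ A <;> simp only [unitIndicator, hmem, h, if_true, if_false]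
    rwa [this, dist_self]
  · have h := hf.isAdditiveClass_preimage (isOpen_Iio (a := (1 : Set.Icc (0 : ℝ) 1)))
    have hAc : unitIndicator A ⁻¹' Iio 1 = Aᶜ := by
      ext x
      by_cases hx : x ∈ A <;> simp [unitIndicator, hx]
    rwa [hAc] at h
  · simpa only [A, mem_preimage, EllInfty.limsup_eq_of_encard_le_one hx] using ha
  · by_cases hx : x ∈ A <;> simp [unitIndicator, hx]
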